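/- Qubits have basis states $0,1$; an operator on a finite set of qubits is a complex matrix in the computational basis. A \emph{one-layer circuit} is a tensor product of arbitrary one- and two-qubit unitary gates in which each qubit belongs to exactly one gate (possibly the identity; two-qubit gates may couple any two qubits). A \emph{circuit of depth $d$} is a product of $d$ one-layer circuits. An operator $F$ on $n$ qubits is \emph{embedded} in an operator $M$ on $n+m$ qubits, with $m$ ancillae, if $M(|x\rangle\otimes|0\rangle^{\otimes m})=(F|x\rangle)\otimes|0\rangle^{\otimes m}$ for every $x\in\{0,1\}^n$. There are circuits composed of controlled-not gates and one-qubit diagonal gates that cannot be parallelized to less than exponential depth with a polynomial number of ancillae. Precisely, there is a family $(C_n)_{n\ge 0}$, where $C_n$ is a finite circuit on $n$ qubits composed of controlled-not gates and one-qubit diagonal gates $\mathrm{diag}(e^{i\theta_0},e^{i\theta_1})$, $\theta_0,\theta_1\in\mathbb R$, with the following two properties. Let $F_n$ be the operator performed by $C_n$. (i) There is a constant $K>0$ such that for all $n\ge 1$ and all $m,d\ge 0$: if $F_n$ is embedded, with $m$ ancillae, in a circuit of depth $d$, then $2^n\le K\,d\,(m+n)$. (ii) There is a constant $a>1$ such that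 for all $c\in\mathbb R$ and $j\in\mathbb N$ there is $N$ such that for all $n\ge N$, all $m\le c\,n^j$ and all $d\ge 0$: if $F_n$ is embedded, with $m$ ancillae, in a circuit of depth $d$, then $d\ge a^n$. -/

import Mathlib

noncomputable section

namespace QCirc

/-- Computational basis states of a register of qubits indexed by `ι`. -/
abbrev Basis (ι : Type) : Type := ι → Bool

/-- Operators on a register of qubits indexed by `ι`, as matrices in the computational basis.
Rows are indexed by the outgoing basis state and columns by the incoming one. -/
abbrev Op (ι : Type) : Type := Matrix (Basis ι) (Basis ι) ℂ

/-- A one-layer circuit: the qubits are partitioned into blocks of one or two qubits,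
and the operator is the tensor product over the blocks of arbitrary one- and two-qubit unitary
gates.  A qubit on which nothing is done is a block with the identity gate; the two
qubits of a block need not be adjacent.  (Only the values of `U` on blocks of `P` matter.) -/
def IsOneLayer {ι : Type} [Fintype ι] [DecidableEq ι] (A : Op ι) : Prop :=
  ∃ (P : Finpartition (Finset.univ : Finset ι))
    (U : (B : Finset ι) → Matrix (B → Bool) (B → Bool) ℂ),
    (∀ B ∈ P.parts, B.card ≤ 2 ∧ U B ∈ Matrix.unitaryGroup (B → Bool) ℂ) ∧
    ∀ y x : Basis ι, A y x = ∏ B ∈ P.parts, U B (fun i => y i) (fun i => x i)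

/-- A quantum circuit of depth `d`: an operator that is the product of `d` one-layer circuits. -/
def IsCircuitOfDepth {ι : Type} [Fintype ι] [DecidableEq ι] (d : ℕ) (M : Op ι) : Prop :=
  ∃ L : List (Op ι), L.length = d ∧ (∀ A ∈ L, IsOneLayer A) ∧ M = L.prod

/-- `F`, an operator on `n` qubits, is embedded in the operator `M` on these `n` qubits together
with `m` ancillae: `M` maps `|x⟩ ⊗ |0…0⟩` to `(F |x⟩) ⊗ |0…0⟩` for every basis state `x`, that is,
`M` preserves the subspace where the ancillae are zero and acts on it as `F` does on the
`n` qubits. -/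
def IsEmbedded {n m : ℕ} (F : Op (Fin n)) (M : Op (Fin n ⊕ Fin m)) : Prop :=
  ∀ (x y : Basis (Fin n)) (a : Basis (Fin m)),
    M (Sum.elim y a) (Sum.elim x (fun _ => false)) = if a = (fun _ => false) then F y x else 0

/-- The elementary gates: controlled-not gates (with distinct input and target qubits) and
one-qubit diagonal gates `diag(e^{iθ₀}, e^{iθ₁})`. -/
inductive CnotDiagGate (n : ℕ) : Type
  | cnot (input target : Fin n) (h : input ≠ target) : CnotDiagGate n
  | diag (q : Fin n) (θ : Bool → ℝ) : CnotDiagGate n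

/-- The operator on `n` qubits performed by an elementary gate. -/
def CnotDiagGate.op {n : ℕ} : CnotDiagGate n → Op (Fin n)
  | .cnot c t _ => Matrix.of fun y x =>
      if y = Function.update x t (xor (x c) (x t)) then 1 else 0
  | .diag q θ => Matrix.diagonal fun x => Complex.exp ((θ (x q) : ℂ) * Complex.I)

/-- The operator performed by a circuit of elementary gates, the head of the list being
the gate that is applied first. -/
def circuitOp {n : ℕ} : List (CnotDiagGate n) → Op (Fin n)
  | [] => 1
  | g :: L => circuitOp L * g.op

end QCirc

end

/-! The proof counts parameters. Controlled-not and diagonal gates generate every diagonal unitary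
(`isRealizable_of_neZero`), so for n ≥ 1 the operator can be chosen diagonal with its 2^n phases
algebraically independent over ℚ (`exists_algebraicIndependent_phases`). The entries of a depth-d
circuit on n + m qubits are rational polynomials in at most 16 d (n + m) gate entries
(`IsCircuitOfDepth.exists_adjoin`). When the operator is embedded, its phases are among these
entries, so comparing transcendence degrees gives 2^n ≤ 16 d (n + m). With polynomially many
ancillae, this forces d to be exponential. -/

namespace QCirc

open Finset

/-! ### Synthesis of diagonal operators -/

/-- The diagonal operator with phases `exp (i φ x)`. -/
noncomputable def phaseOp {n : ℕ} (φ : Basis (Fin n) → ℝ) : Op (Fin n) :=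
  Matrix.diagonal fun x => Complex.exp ((φ x : ℂ) * Complex.I)

/-- The diagonal operator with phase function `φ` is performed by a circuit of controlled-not
gates and one-qubit diagonal gates. -/
def IsRealizable {n : ℕ} (φ : Basis (Fin n) → ℝ) : Prop :=
  ∃ L : List (CnotDiagGate n), circuitOp L = phaseOp φ

theorem circuitOp_append {n : ℕ} (L L' : List (CnotDiagGate n)) :
    circuitOp (L ++ L') = circuitOp L' * circuitOp L := by
  induction L with
  | nil => simp [circuitOp]
  | cons g L ih => simp [circuitOp, ih, mul_assoc]

theorem isRealizable_zero {n : ℕ} : IsRealizable (0 : Basis (Fin n) → ℝ) :=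
  ⟨[], by simp [circuitOp, phaseOp]⟩

theorem IsRealizable.add {n : ℕ} {φ ψ : Basis (Fin n) → ℝ} (hφ : IsRealizable φ)
    (hψ : IsRealizable ψ) : IsRealizable (φ + ψ) := by
  obtain ⟨L, hL⟩ := hφ
  obtain ⟨L', hL'⟩ := hψ
  refine ⟨L ++ L', ?_⟩
  rw [circuitOp_append, hL, hL', phaseOp, phaseOp, phaseOp, Matrix.diagonal_mul_diagonal]
  congr 1
  funext x
  rw [← Complex.exp_add]
  congr 1
  push_cast [Pi.add_apply]
  ring

theorem IsRealizable.sum {n : ℕ} {κ : Type*} (s : Finset κ) {φ : κ → Basis (Fin n) → ℝ}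
    (h : ∀ k ∈ s, IsRealizable (φ k)) : IsRealizable (∑ k ∈ s, φ k) :=
  Finset.sum_induction φ IsRealizable (fun _ _ => IsRealizable.add) isRealizable_zero h

theorem isRealizable_single {n : ℕ} (q : Fin n) (θ : Bool → ℝ) :
    IsRealizable fun x : Basis (Fin n) => θ (x q) :=
  ⟨[.diag q θ], by simp [circuitOp, CnotDiagGate.op, phaseOp]⟩

/-- The action of a controlled-not gate on basis states. -/
def cnotMap {n : ℕ} (c t : Fin n) (x : Basis (Fin n)) : Basis (Fin n) :=
  Function.update x t (xor (x c) (x t))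

theorem cnotMap_cnotMap {n : ℕ} {c t : Fin n} (h : c ≠ t) (x : Basis (Fin n)) :
    cnotMap c t (cnotMap c t x) = x := by
  funext i
  by_cases hi : i = t
  · subst hi
    simp [cnotMap, Function.update_of_ne h]
  · simp [cnotMap, Function.update_of_ne hi]

theorem cnot_mul_cnot {n : ℕ} {c t : Fin n} (h : c ≠ t) :
    (CnotDiagGate.cnot c t h).op * (CnotDiagGate.cnot c t h).op = 1 := by
  ext y x
  have hx : Function.update (cnotMap c t x) t (xor (cnotMap c t x c) (cnotMap c t x t)) = x :=
    cnotMap_cnotMap h x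
  rw [Matrix.mul_apply, Finset.sum_eq_single (cnotMap c t x)]
  · simp only [CnotDiagGate.op, Matrix.of_apply, hx, Matrix.one_apply]
    simp [cnotMap]
  · intro z _ hz
    have hz' : z ≠ Function.update x t (xor (x c) (x t)) := hz
    simp [CnotDiagGate.op, hz']
  · simp

theorem phaseOp_mul_cnot {n : ℕ} {c t : Fin n} (h : c ≠ t) (φ : Basis (Fin n) → ℝ) :
    phaseOp φ * (CnotDiagGate.cnot c t h).op =
      (CnotDiagGate.cnot c t h).op * phaseOp fun x => φ (cnotMap c t x) := by
  ext y x
  rw [phaseOp, phaseOp, Matrix.diagonal_mul, Matrix.mul_diagonal]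
  by_cases hy : y = Function.update x t (xor (x c) (x t))
  · subst hy
    simp [CnotDiagGate.op, cnotMap]
  · simp [CnotDiagGate.op, hy]

/-- Conjugating a diagonal operator by a controlled-not permutes its phases. -/
theorem IsRealizable.comp_cnotMap {n : ℕ} {φ : Basis (Fin n) → ℝ} (hφ : IsRealizable φ)
    {c t : Fin n} (h : c ≠ t) : IsRealizable fun x => φ (cnotMap c t x) := by
  obtain ⟨L, hL⟩ := hφ
  refine ⟨.cnot c t h :: (L ++ [.cnot c t h]), ?_⟩
  simp only [circuitOp, circuitOp_append, hL, one_mul]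
  rw [mul_assoc, phaseOp_mul_cnot, ← mul_assoc, cnot_mul_cnot, one_mul]

/-- The sign `(-1) ^ b`. -/
noncomputable def boolSign (b : Bool) : ℝ := if b then -1 else 1

theorem boolSign_xor (a b : Bool) : boolSign (xor a b) = boolSign a * boolSign b := by
  cases a <;> cases b <;> simp [boolSign]

/-- Starting from a diagonal gate on `t`, each conjugation by a controlled-not from `c` to `t` adds
`x c` to the parity held on `t`. -/
theorem isRealizable_sign_mul_prod {n : ℕ} (t : Fin n) (a : ℝ) (S : Finset (Fin n)) :
    t ∉ S → IsRealizable fun x => a * (boolSign (x t) * ∏ i ∈ S, boolSign (x i)) := by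
  induction S using Finset.induction_on with
  | empty =>
    intro _
    simpa using isRealizable_single t fun b => a * boolSign b
  | insert c S hc ih =>
    intro ht
    rw [Finset.mem_insert, not_or] at ht
    convert (ih ht.2).comp_cnotMap (Ne.symm ht.1) using 2 with x
    rw [Finset.prod_insert hc]
    have hS : ∏ i ∈ S, boolSign (cnotMap c t x i) = ∏ i ∈ S, boolSign (x i) :=
      Finset.prod_congr rfl fun i hi => by
        rw [cnotMap, Function.update_of_ne (ne_of_mem_of_not_mem hi ht.2)]
    rw [hS, cnotMap, Function.update_self, boolSign_xor]
    ring

theorem isRealizable_character {n : ℕ} [NeZero n] (a : ℝ) (S : Finset (Fin n)) :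
    IsRealizable fun x => a * ∏ i ∈ S, boolSign (x i) := by
  obtain rfl | ⟨t, ht⟩ := S.eq_empty_or_nonempty
  -- A global phase still has to be placed on some qubit, hence `NeZero n`.
  · simpa using isRealizable_single (0 : Fin n) fun _ => a
  · convert isRealizable_sign_mul_prod t a (S.erase t) (Finset.notMem_erase t S) using 3 with x
    rw [Finset.mul_prod_erase S (fun i => boolSign (x i)) ht]

theorem prod_one_add_boolSign {n : ℕ} (x y : Basis (Fin n)) :
    ∏ i, (1 + boolSign (y i) * boolSign (x i)) = if x = y then (2 : ℝ) ^ n else 0 := by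
  split_ifs with h
  · subst h
    have : ∀ b, 1 + boolSign b * boolSign b = 2 := by
      intro b; cases b <;> norm_num [boolSign]
    simp [this]
  · obtain ⟨i, hi⟩ := Function.ne_iff.mp h
    refine Finset.prod_eq_zero (Finset.mem_univ i) ?_
    revert hi
    cases x i <;> cases y i <;> simp [boolSign]

/-- Controlled-not gates and one-qubit diagonal gates generate all diagonal unitaries. -/
theorem isRealizable_of_neZero {n : ℕ} [NeZero n] (φ : Basis (Fin n) → ℝ) : IsRealizable φ := by
  -- Fourier expansion of `φ` on (ℤ/2)^n: each point mass is a combination of characters.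
  have key : φ = ∑ y : Basis (Fin n), ∑ S ∈ (univ : Finset (Fin n)).powerset,
      fun x => (φ y / 2 ^ n * ∏ i ∈ S, boolSign (y i)) * ∏ i ∈ S, boolSign (x i) := by
    funext x
    have hy : ∀ y : Basis (Fin n), ∑ S ∈ (univ : Finset (Fin n)).powerset,
        (φ y / 2 ^ n * ∏ i ∈ S, boolSign (y i)) * ∏ i ∈ S, boolSign (x i)
          = if x = y then φ y else 0 := by
      intro y
      have := prod_one_add_boolSign x y
      rw [Finset.prod_one_add] at this
      simp only [mul_assoc, ← Finset.prod_mul_distrib, ← Finset.mul_sum, this]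
      split_ifs <;> simp
    simp only [Finset.sum_apply, hy]
    simp
  rw [key]
  exact IsRealizable.sum _ fun y _ => IsRealizable.sum _ fun S _ => isRealizable_character _ S

/-! ### Algebraically independent points of the unit circle -/

theorem not_countable_range_exp_mul_I :
    ¬ (Set.range fun θ : ℝ => Complex.exp ((θ : ℂ) * Complex.I)).Countable := by
  intro h
  have hinj : Set.InjOn (fun θ : ℝ => Complex.exp ((θ : ℂ) * Complex.I))
      (Set.Ioc (-Real.pi) Real.pi) := by
    intro a ha b hb hab
    have := congrArg Complex.arg hab
    simpa only [Complex.arg_exp_mul_I, (toIocMod_eq_self Real.two_pi_pos).mpr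
      (show a ∈ Set.Ioc (-Real.pi) (-Real.pi + 2 * Real.pi) by
        rwa [show -Real.pi + 2 * Real.pi = Real.pi by ring]),
      (toIocMod_eq_self Real.two_pi_pos).mpr
      (show b ∈ Set.Ioc (-Real.pi) (-Real.pi + 2 * Real.pi) by
        rwa [show -Real.pi + 2 * Real.pi = Real.pi by ring])] using this
  have hc := Set.MapsTo.countable_of_injOn (fun θ _ => Set.mem_range_self θ) hinj h
  rw [Cardinal.Real.Ioc_countable_iff] at hc
  linarith [Real.pi_pos]

theorem countable_adjoin {s : Set ℂ} (hs : s.Countable) :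
    Countable (Algebra.adjoin ℚ s) := by
  have := hs.to_subtype
  have hsurj : Function.Surjective (MvPolynomial.aeval ((↑) : s → ℂ) :
      MvPolynomial s ℚ →ₐ[ℚ] ℂ).rangeRestrict := AlgHom.rangeRestrict_surjective _
  have hcard : Cardinal.mk (MvPolynomial s ℚ) ≤ Cardinal.aleph0 :=
    MvPolynomial.cardinalMk_le_max.trans (by simp [Cardinal.mk_le_aleph0])
  have : Countable (MvPolynomial s ℚ) := Cardinal.mk_le_aleph0_iff.mp hcard
  rw [Algebra.adjoin_eq_range]
  exact hsurj.countable

/-- An uncountable set of complex numbers contains infinitely many algebraically independent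
elements. -/
theorem exists_infinite_algebraicIndepOn {t : Set ℂ} (ht : ¬ t.Countable) :
    ∃ u ⊆ t, u.Infinite ∧ AlgebraicIndepOn ℚ id u := by
  obtain ⟨u, -, hu⟩ := exists_maximal_algebraicIndependent (R := ℚ) (∅ : Set ℂ) t
    (Set.empty_subset _)
    ((algebraicIndependent_empty_iff ..).mpr (FaithfulSMul.algebraMap_injective ℚ ℂ))
  refine ⟨u, hu.prop.2, fun hfin => ht ?_, hu.prop.1⟩
  have := countable_adjoin hfin.countable
  -- By maximality of `u`, all of `t` is algebraic over ℚ[u], which is countable if `u` is finite.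
  refine (Algebraic.countable (Algebra.adjoin ℚ u) ℂ).mono fun z hz => ?_
  by_contra hz'
  have hins : AlgebraicIndepOn ℚ id (insert z u) :=
    hu.prop.1.insert (by rw [Set.image_id]; exact hz')
  have hmem : z ∈ u := hu.2 ⟨hins, Set.insert_subset hz hu.prop.2⟩ (Set.subset_insert _ _)
    (Set.mem_insert _ _)
  exact hz' (isAlgebraic_algebraMap (⟨z, Algebra.subset_adjoin hmem⟩ : Algebra.adjoin ℚ u))

theorem exists_algebraicIndependent_phases (ι : Type) [Finite ι] :
    ∃ φ : ι → ℝ, AlgebraicIndependent ℚ fun i => Complex.exp ((φ i : ℂ) * Complex.I) := by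
  obtain ⟨u, hut, hinf, hind⟩ := exists_infinite_algebraicIndepOn not_countable_range_exp_mul_I
  have := hinf.to_subtype
  obtain ⟨k, ⟨e⟩⟩ := Finite.exists_equiv_fin ι
  let f : ι ↪ u := e.toEmbedding.trans (Fin.valEmbedding.trans (Infinite.natEmbedding u))
  choose φ hφ using fun i => hut (f i).2
  refine ⟨φ, ?_⟩
  simp only [hφ]
  exact AlgebraicIndependent.comp hind f f.injective

/-! ### Transcendence degree of the entries of a circuit -/

/-- ℚ[W] is a quotient of a polynomial ring in #W variables, which bounds its transcendence degree.
-/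
theorem card_le_of_algebraicIndependent_of_mem_adjoin {ι : Type} [Fintype ι] {v : ι → ℂ}
    (hv : AlgebraicIndependent ℚ v) (W : Finset ℂ)
    (hW : ∀ i, v i ∈ Algebra.adjoin ℚ (W : Set ℂ)) : Fintype.card ι ≤ #W := by
  let w : ι → Algebra.adjoin ℚ (W : Set ℂ) := fun i => ⟨v i, hW i⟩
  have hw : AlgebraicIndependent ℚ w :=
    AlgebraicIndependent.of_comp (Algebra.adjoin ℚ (W : Set ℂ)).val hv
  have h1 := hw.cardinalMk_le_trdeg
  have h2 : Algebra.trdeg ℚ (Algebra.adjoin ℚ (W : Set ℂ)) ≤ Cardinal.mk W := by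
    have hsurj : Function.Surjective (MvPolynomial.aeval ((↑) : ↥(W : Set ℂ) → ℂ) :
        MvPolynomial (W : Set ℂ) ℚ →ₐ[ℚ] ℂ).rangeRestrict := AlgHom.rangeRestrict_surjective _
    rw [Algebra.adjoin_eq_range]
    refine (trdeg_le_of_surjective _ hsurj).trans ?_
    rw [MvPolynomial.trdeg_of_isDomain]
    simp
  have h3 := h1.trans h2
  rw [Cardinal.mk_fintype, Cardinal.mk_coe_finset] at h3
  exact_mod_cast h3

/-- A gate on at most two qubits has at most 4 · 4 = 16 entries, and there are at most as many gates
as qubits. -/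
theorem IsOneLayer.exists_adjoin {ι : Type} [Fintype ι] [DecidableEq ι] {A : Op ι}
    (hA : IsOneLayer A) : ∃ W : Finset ℂ, #W ≤ 16 * Fintype.card ι ∧
      ∀ y x, A y x ∈ Algebra.adjoin ℚ (W : Set ℂ) := by
  obtain ⟨P, U, hU, hA⟩ := hA
  refine ⟨P.parts.biUnion fun B => univ.image fun p : (B → Bool) × (B → Bool) => U B p.1 p.2,
    ?_, fun y x => ?_⟩
  · refine (Finset.card_biUnion_le_card_mul _ _ 16 fun B hB => ?_).trans ?_
    · refine Finset.card_image_le.trans ?_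
      have hcard : Fintype.card (B → Bool) ≤ 4 := by
        rw [Fintype.card_fun, Fintype.card_bool, Fintype.card_coe]
        exact Nat.pow_le_pow_right two_pos (hU B hB).1
      rw [Finset.card_univ, Fintype.card_prod]
      exact Nat.mul_le_mul hcard hcard
    · rw [mul_comm]
      exact Nat.mul_le_mul_left _ P.card_parts_le_card
  · rw [hA]
    refine Subalgebra.prod_mem _ fun B hB => Algebra.subset_adjoin ?_
    rw [Finset.mem_coe, Finset.mem_biUnion]
    exact ⟨B, hB, Finset.mem_image.mpr ⟨(_, _), Finset.mem_univ _, rfl⟩⟩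

/-- The entries of a circuit of depth `d` are polynomials in the entries of its gates. -/
theorem IsCircuitOfDepth.exists_adjoin {ι : Type} [Fintype ι] [DecidableEq ι] {d : ℕ} {M : Op ι}
    (hM : IsCircuitOfDepth d M) : ∃ W : Finset ℂ, #W ≤ 16 * (d * Fintype.card ι) ∧
      ∀ y x, M y x ∈ Algebra.adjoin ℚ (W : Set ℂ) := by
  obtain ⟨L, rfl, hL, rfl⟩ := hM
  induction L with
  | nil =>
    refine ⟨∅, by simp, fun y x => ?_⟩
    rw [List.prod_nil, Matrix.one_apply]
    split_ifs
    · exact one_mem _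
    · exact zero_mem _
  | cons A L ih =>
    obtain ⟨W, hW, hWm⟩ := ih fun B hB => hL B (List.mem_cons_of_mem _ hB)
    obtain ⟨V, hV, hVm⟩ := (hL A List.mem_cons_self).exists_adjoin
    refine ⟨V ∪ W, ?_, fun y x => ?_⟩
    · refine (Finset.card_union_le _ _).trans ?_
      rw [List.length_cons]
      linarith
    · rw [List.prod_cons, Matrix.mul_apply]
      refine Subalgebra.sum_mem _ fun z _ => mul_mem ?_ ?_
      · exact Algebra.adjoin_mono (by simp) (hVm y z)
      · exact Algebra.adjoin_mono (by simp) (hWm z x)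

theorem two_pow_le_of_isEmbedded_phaseOp {n m d : ℕ} {φ : Basis (Fin n) → ℝ}
    (hφ : AlgebraicIndependent ℚ fun x => Complex.exp ((φ x : ℂ) * Complex.I))
    {M : Op (Fin n ⊕ Fin m)} (hM : IsCircuitOfDepth d M) (hF : IsEmbedded (phaseOp φ) M) :
    2 ^ n ≤ 16 * (d * (m + n)) := by
  obtain ⟨W, hW, hWm⟩ := hM.exists_adjoin
  have hcard := card_le_of_algebraicIndependent_of_mem_adjoin hφ W fun x => by
    have h := hF x x fun _ => false
    rw [if_pos rfl, phaseOp, Matrix.diagonal_apply_eq] at h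
    rw [← h]
    exact hWm _ _
  simp only [Fintype.card_fun, Fintype.card_bool, Fintype.card_fin, Fintype.card_sum] at hcard hW
  rw [add_comm m n]
  exact hcard.trans hW

theorem exists_forall_pow_mul_le_two_pow {K : ℝ} (hK : 0 < K) (c : ℝ) (j : ℕ) :
    ∃ N : ℕ, ∀ n ≥ N, 1 ≤ n ∧ (3 / 2 : ℝ) ^ n * (K * (c * (n : ℝ) ^ j + n)) ≤ 2 ^ n := by
  -- The ratio 3/4 is (3/2)/2; degree j + 1 dominates both n^j and n, even for j = 0.
  have hlim := tendsto_pow_const_mul_const_pow_of_lt_one (j + 1) (r := 3 / 4)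
    (by norm_num) (by norm_num)
  have hpos : 0 < (K * (|c| + 1))⁻¹ := by positivity
  obtain ⟨N, hN⟩ := Filter.eventually_atTop.mp
    ((hlim.eventually_lt_const hpos).and (Filter.eventually_ge_atTop 1))
  refine ⟨N, fun n hn => ⟨(hN n hn).2, ?_⟩⟩
  obtain ⟨hlt, hn1⟩ := hN n hn
  have hn1' : (1 : ℝ) ≤ n := by exact_mod_cast hn1
  have h1 : c * (n : ℝ) ^ j + n ≤ (|c| + 1) * (n : ℝ) ^ (j + 1) := by
    have ha : c * (n : ℝ) ^ j ≤ |c| * (n : ℝ) ^ (j + 1) :=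
      mul_le_mul (le_abs_self c) (pow_le_pow_right₀ hn1' (Nat.le_succ j)) (by positivity)
        (abs_nonneg c)
    have hb : (n : ℝ) ≤ (n : ℝ) ^ (j + 1) := le_self_pow₀ hn1' (Nat.succ_ne_zero j)
    linarith
  have h2 : K * (|c| + 1) * ((n : ℝ) ^ (j + 1) * (3 / 4) ^ n) ≤ 1 := by
    rw [← le_inv_mul_iff₀ (by positivity), mul_one]
    exact hlt.le
  have h3 : (3 / 2 : ℝ) ^ n = (3 / 4) ^ n * 2 ^ n := by rw [← mul_pow]; norm_num
  calc (3 / 2 : ℝ) ^ n * (K * (c * (n : ℝ) ^ j + n))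
      ≤ (3 / 2 : ℝ) ^ n * (K * ((|c| + 1) * (n : ℝ) ^ (j + 1))) := by gcongr
    _ = K * (|c| + 1) * ((n : ℝ) ^ (j + 1) * (3 / 4) ^ n) * 2 ^ n := by rw [h3]; ring
    _ ≤ 1 * 2 ^ n := by gcongr
    _ = 2 ^ n := one_mul _

theorem exists_circuit_two_pow_le (n : ℕ) : ∃ L : List (CnotDiagGate n), 1 ≤ n →
    ∀ (m d : ℕ) (M : Op (Fin n ⊕ Fin m)), IsCircuitOfDepth d M → IsEmbedded (circuitOp L) M →
      2 ^ n ≤ 16 * (d * (m + n)) := by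
  obtain rfl | hn := Nat.eq_zero_or_pos n
  · exact ⟨[], fun h => absurd h (by norm_num)⟩
  · have : NeZero n := ⟨hn.ne'⟩
    obtain ⟨φ, hφ⟩ := exists_algebraicIndependent_phases (Basis (Fin n))
    obtain ⟨L, hL⟩ := isRealizable_of_neZero φ
    refine ⟨L, fun _ m d M hM hF => two_pow_le_of_isEmbedded_phaseOp hφ hM ?_⟩
    rwa [hL] at hF

end QCirc

theorem mainTheorem3 :
    ∃ C : (n : ℕ) → List (QCirc.CnotDiagGate n),
      (∃ K : ℝ, 0 < K ∧ ∀ n : ℕ, 1 ≤ n → ∀ (m d : ℕ) (M : QCirc.Op (Fin n ⊕ Fin m)),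
        QCirc.IsCircuitOfDepth d M → QCirc.IsEmbedded (QCirc.circuitOp (C n)) M →
          (2 : ℝ) ^ n ≤ K * ((d : ℝ) * ((m : ℝ) + (n : ℝ)))) ∧
      (∃ a : ℝ, 1 < a ∧ ∀ (c : ℝ) (j : ℕ), ∃ N : ℕ, ∀ n : ℕ, N ≤ n →
        ∀ m : ℕ, (m : ℝ) ≤ c * (n : ℝ) ^ j → ∀ (d : ℕ) (M : QCirc.Op (Fin n ⊕ Fin m)),
          QCirc.IsCircuitOfDepth d M → QCirc.IsEmbedded (QCirc.circuitOp (C n)) M →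
            a ^ n ≤ (d : ℝ)) := by
  choose C hC using QCirc.exists_circuit_two_pow_le
  have hbound : ∀ n : ℕ, 1 ≤ n → ∀ (m d : ℕ) (M : QCirc.Op (Fin n ⊕ Fin m)),
      QCirc.IsCircuitOfDepth d M → QCirc.IsEmbedded (QCirc.circuitOp (C n)) M →
        (2 : ℝ) ^ n ≤ 16 * ((d : ℝ) * ((m : ℝ) + (n : ℝ))) := fun n hn m d M hM hF => by
    exact_mod_cast hC n hn m d M hM hF
  refine ⟨C, ⟨16, by norm_num, hbound⟩, 3 / 2, by norm_num, fun c j => ?_⟩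
  obtain ⟨N, hN⟩ := QCirc.exists_forall_pow_mul_le_two_pow (K := 16) (by norm_num) c j
  refine ⟨N, fun n hn m hm d M hM hF => ?_⟩
  obtain ⟨hn1, hle⟩ := hN n hn
  have hpos : (0 : ℝ) < 16 * ((m : ℝ) + n) := by positivity
  refine le_of_mul_le_mul_right ?_ hpos
  calc (3 / 2 : ℝ) ^ n * (16 * ((m : ℝ) + n))
      ≤ (3 / 2 : ℝ) ^ n * (16 * (c * (n : ℝ) ^ j + n)) := by gcongr
    _ ≤ 2 ^ n := hle
    _ ≤ 16 * ((d : ℝ) * ((m : ℝ) + n)) := hbound n hn1 m d M hM hF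
    _ = d * (16 * ((m : ℝ) + n)) := by ring
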